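/- Let $n\ge 1$ and let $0<t<s<1$. Then there exists a compact set $E\subset\mathbb{R}^n$ such that $$\underline{\dim}_{MB}E=\underline{\dim}_{B}E=t\qquad\text{and}\qquad \overline{\dim}_{C}E=\dim_{P}E=s .$$ Here $B(x,r)$ is the closed Euclidean ball and $|U|$ is the diameter of $U$, and the dimensions are defined as follows. * Lower box dimension: $\displaystyle\underline{\dim}_B E=\liminf_{r\to0^+}\frac{\log N_r(E)}{-\log r}$, where $N_r(E)$ is the least number of sets of diameter at most $r$ that cover $E$. * Modified lower box dimension: $\displaystyle\underline{\dim}_{MB}E=\inf\Big\{\sup_i\underline{\dim}_B E_i : E\subset\bigcup_{i=1}^\infty E_i,\ E_i\text{ compact}\Big\}$. * Upper correlation dimension: $\displaystyle\overline{\dim}_C E=\sup_{\mu}\ \limsup_{r\to0^+}\frac{\log\int\mu(B(x,r))\,d\mu(x)}{\log r}$, the supremum being over all Borel probability measures $\mu$ on $\mathbb{R}^n$ supported by $E$, that is, with $\mu(\mathbb{R}^n\setminus E)=0$. * Packing dimension: $\dim_P E=\inf\{u\ge0:\mathcal{P}^u(E)=0\}$, where $\mathcal{P}^u(E)=\inf\{\sum_{i=1}^\infty\mathcal{P}^u_0(E_i):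 E\subset\bigcup_{i=1}^\infty E_i\}$, $\mathcal{P}^u_0(A)=\inf_{\delta>0}\mathcal{P}^u_\delta(A)$, and $\mathcal{P}^u_\delta(A)$ is the supremum of $\sum_i|B_i|^u$ over all countable families $\{B_i\}$ of disjoint closed balls of positive radius at most $\delta$ with centres in $A$. -/

import Mathlib

open Filter Topology MeasureTheory
open scoped ENNReal

noncomputable section

namespace FractalDim

/-- Least number of sets of diameter at most `r` needed to cover `E` (`⊤` if no finite cover
exists). -/
def coverNumber {d : ℕ} (r : ℝ) (E : Set (EuclideanSpace ℝ (Fin d))) : ℕ∞ :=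
  ⨅ (k : ℕ) (_ : ∃ U : Fin k → Set (EuclideanSpace ℝ (Fin d)),
      (∀ i, Metric.ediam (U i) ≤ ENNReal.ofReal r) ∧ E ⊆ ⋃ i, U i), (k : ℕ∞)

/-- Lower box-counting dimension: `liminf` as `r → 0+` of `log N_r(E) / (-log r)`. -/
def lowerBoxDim {d : ℕ} (E : Set (EuclideanSpace ℝ (Fin d))) : EReal :=
  liminf (fun r : ℝ => ENNReal.log (coverNumber r E : ℝ≥0∞) / ((-Real.log r : ℝ) : EReal))
    (𝓝[>] (0 : ℝ))

/-- Modified lower box dimension: infimum of `sup_i (lowerBoxDim (F i))` over all countable covers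
of `E` by compact sets. -/
def modifiedLowerBoxDim {d : ℕ} (E : Set (EuclideanSpace ℝ (Fin d))) : EReal :=
  ⨅ (F : ℕ → Set (EuclideanSpace ℝ (Fin d))) (_ : ∀ i, IsCompact (F i)) (_ : E ⊆ ⋃ i, F i),
    ⨆ i, lowerBoxDim (F i)

/-- Upper correlation dimension of a measure: `limsup` as `r → 0+` of
`log (∫ μ(B(x,r)) dμ(x)) / log r`, with `B(x,r)` the closed ball. -/
def upperCorrDimMeasure {d : ℕ} (μ : Measure (EuclideanSpace ℝ (Fin d))) : EReal :=
  limsup (fun r : ℝ =>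
      ENNReal.log (∫⁻ x, μ (Metric.closedBall x r) ∂μ) / ((Real.log r : ℝ) : EReal))
    (𝓝[>] (0 : ℝ))

/-- Upper correlation dimension of a set: supremum over the Borel probability measures
supported by `E`. -/
def upperCorrDim {d : ℕ} (E : Set (EuclideanSpace ℝ (Fin d))) : EReal :=
  ⨆ (μ : Measure (EuclideanSpace ℝ (Fin d))) (_ : IsProbabilityMeasure μ) (_ : μ Eᶜ = 0),
    upperCorrDimMeasure μ

/-- A `δ`-packing of `E`: a countable family of disjoint closed balls with centres in `E` and
(positive) radii at most `δ`; a ball is recorded as the pair (centre, radius). -/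
structure IsPacking {d : ℕ} (δ : ℝ) (E : Set (EuclideanSpace ℝ (Fin d)))
    (B : Set (EuclideanSpace ℝ (Fin d) × ℝ)) : Prop where
  countable : B.Countable
  center_mem : ∀ b ∈ B, b.1 ∈ E
  radius_pos : ∀ b ∈ B, 0 < b.2
  radius_le : ∀ b ∈ B, b.2 ≤ δ
  disjoint : B.PairwiseDisjoint fun b => Metric.closedBall b.1 b.2

/-- Supremum of `∑ |B_i| ^ s` over the `δ`-packings of `E`. -/
def packingPreDelta {d : ℕ} (s δ : ℝ) (E : Set (EuclideanSpace ℝ (Fin d))) : ℝ≥0∞ :=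
  ⨆ (B : Set (EuclideanSpace ℝ (Fin d) × ℝ)) (_ : IsPacking δ E B),
    ∑' b : B, Metric.ediam (Metric.closedBall b.1.1 b.1.2) ^ s

/-- The `s`-dimensional packing premeasure. -/
def packingPre {d : ℕ} (s : ℝ) (E : Set (EuclideanSpace ℝ (Fin d))) : ℝ≥0∞ :=
  ⨅ (δ : ℝ) (_ : 0 < δ), packingPreDelta s δ E

/-- The `s`-dimensional packing measure. -/
def packingMeasure {d : ℕ} (s : ℝ) (E : Set (EuclideanSpace ℝ (Fin d))) : ℝ≥0∞ :=
  ⨅ (F : ℕ → Set (EuclideanSpace ℝ (Fin d))) (_ : E ⊆ ⋃ i, F i), ∑' i, packingPre s (F i)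

/-- Packing dimension. -/
def packingDim {d : ℕ} (E : Set (EuclideanSpace ℝ (Fin d))) : EReal :=
  ⨅ (s : ℝ) (_ : 0 ≤ s) (_ : packingMeasure s E = 0), (s : EReal)

end FractalDim

end

/-! The set is a Cantor set on a coordinate axis whose `2 ^ k` pieces of level `k` have diameter at
most `ℓ k`, while points that separate at or before digit `k` are at least `δ * ℓ k` apart. Its fair
coin-tossing measure gives each piece mass `2 ^ (-k)`. Hence covering numbers and ball masses at
scales near `ℓ k` are governed by the ratio of `k * log 2` to `-log (ℓ k)`. The liminf of this ratio
controls both lower box dimensions, its limsup the correlation and packing dimensions.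

Lower box dimension is bounded above by covering at well-chosen scales. The mass distribution
principle bounds it below, even after passing to a countable cover, since some member carries
positive mass. Upper correlation dimension is bounded above by counting covers
(`inv_card_le_lintegral_measure_closedBall`), packing dimension by comparing disjoint balls with the
measure. Their lower bounds need small ball mass only at arbitrarily small scales, but uniformly in
the centre.

It remains to make the ratio oscillate between `t` and `s`. Put `ℓ k = 2 ^ (-b k)`, where the
increments of `b` are `s⁻¹` or `t⁻¹` on alternating factorial blocks, each long enough to swamp all
earlier ones. -/

namespace FractalDim

/-! ### Power bounds and logarithmic ratios -/

section LogRatio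

variable {x : ℝ≥0∞} {r v : ℝ}

theorem log_div_neg_log_le (hr : 0 < r) (hr1 : r < 1) (h : x ≤ ENNReal.ofReal (r ^ (-v))) :
    ENNReal.log x / ((-Real.log r : ℝ) : EReal) ≤ v := by
  have hL : 0 < -Real.log r := by linarith [Real.log_neg hr hr1]
  rw [EReal.div_le_iff_le_mul (by exact_mod_cast hL) (EReal.coe_ne_top _)]
  refine (ENNReal.log_le_log h).trans ?_
  rw [ENNReal.log_ofReal_of_pos (Real.rpow_pos_of_pos hr _), Real.log_rpow hr]
  norm_cast
  exact le_of_eq (by ring)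

theorem le_log_div_neg_log (hr : 0 < r) (hr1 : r < 1) (h : ENNReal.ofReal (r ^ (-v)) ≤ x) :
    (v : EReal) ≤ ENNReal.log x / ((-Real.log r : ℝ) : EReal) := by
  have hL : 0 < -Real.log r := by linarith [Real.log_neg hr hr1]
  rw [EReal.le_div_iff_mul_le (by exact_mod_cast hL) (EReal.coe_ne_top _)]
  refine le_trans ?_ (ENNReal.log_le_log h)
  rw [ENNReal.log_ofReal_of_pos (Real.rpow_pos_of_pos hr _), Real.log_rpow hr]
  norm_cast
  exact le_of_eq (by ring)

theorem log_div_log_eq (x : ℝ≥0∞) (r : ℝ) : ENNReal.log x / ((Real.log r : ℝ) : EReal) =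
    ENNReal.log x⁻¹ / ((-Real.log r : ℝ) : EReal) := by
  rw [ENNReal.log_inv, EReal.coe_neg, EReal.div_eq_inv_mul, EReal.div_eq_inv_mul, EReal.inv_neg,
    neg_mul_neg]

theorem log_div_log_le (hr : 0 < r) (hr1 : r < 1) (h : ENNReal.ofReal (r ^ v) ≤ x) :
    ENNReal.log x / ((Real.log r : ℝ) : EReal) ≤ v := by
  rw [log_div_log_eq]
  refine log_div_neg_log_le hr hr1 ?_
  rw [Real.rpow_neg hr.le, ENNReal.ofReal_inv_of_pos (Real.rpow_pos_of_pos hr _)]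
  exact ENNReal.inv_le_inv.2 h

theorem le_log_div_log (hr : 0 < r) (hr1 : r < 1) (h : x ≤ ENNReal.ofReal (r ^ v)) :
    (v : EReal) ≤ ENNReal.log x / ((Real.log r : ℝ) : EReal) := by
  rw [log_div_log_eq]
  refine le_log_div_neg_log hr hr1 ?_
  rw [Real.rpow_neg hr.le, ENNReal.ofReal_inv_of_pos (Real.rpow_pos_of_pos hr _)]
  exact ENNReal.inv_le_inv.2 h

theorem eventually_mem_Ioo_nhdsGT_zero : ∀ᶠ r : ℝ in 𝓝[>] 0, r ∈ Set.Ioo (0 : ℝ) 1 :=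
  Ioo_mem_nhdsGT one_pos

/-- Absorbs multiplicative constants at the price of an arbitrarily small loss in the exponent. -/
theorem eventually_const_mul_rpow_le {u : ℝ} (C : ℝ) (huv : u < v) :
    ∀ᶠ r : ℝ in 𝓝[>] 0, C * r ^ v ≤ r ^ u := by
  have h1 : Tendsto (fun r : ℝ => C * r ^ (v - u)) (𝓝[>] 0) (𝓝 0) := by
    have h := (Real.continuousAt_rpow_const (0 : ℝ) (v - u)
      (Or.inr (by linarith : 0 ≤ v - u))).tendsto
    rw [Real.zero_rpow (by linarith)] at h
    simpa using (h.mono_left nhdsWithin_le_nhds).const_mul C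
  filter_upwards [h1.eventually_le_const one_pos, self_mem_nhdsWithin] with r hr hr0
  have hr0 : 0 < r := hr0
  have h2 : r ^ v = r ^ (v - u) * r ^ u := by rw [← Real.rpow_add hr0]; ring_nf
  rw [h2, ← mul_assoc]
  exact mul_le_of_le_one_left (Real.rpow_nonneg hr0.le _) hr

end LogRatio

/-! ### Covering numbers and lower box dimensions -/

variable {d : ℕ}

theorem coverNumber_le {r : ℝ} {E : Set (EuclideanSpace ℝ (Fin d))} {k : ℕ}
    (U : Fin k → Set (EuclideanSpace ℝ (Fin d)))
    (hU : ∀ i, Metric.ediam (U i) ≤ ENNReal.ofReal r) (hE : E ⊆ ⋃ i, U i) :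
    coverNumber r E ≤ k :=
  iInf₂_le k ⟨U, hU, hE⟩

theorem exists_cover_of_coverNumber_ne_top {r : ℝ} {E : Set (EuclideanSpace ℝ (Fin d))}
    (h : coverNumber r E ≠ ⊤) :
    ∃ (k : ℕ) (U : Fin k → Set (EuclideanSpace ℝ (Fin d))), coverNumber r E = k ∧
      (∀ i, Metric.ediam (U i) ≤ ENNReal.ofReal r) ∧ E ⊆ ⋃ i, U i := by
  classical
  by_cases hex : ∃ k : ℕ, ∃ U : Fin k → Set (EuclideanSpace ℝ (Fin d)),
      (∀ i, Metric.ediam (U i) ≤ ENNReal.ofReal r) ∧ E ⊆ ⋃ i, U i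
  · obtain ⟨U, hU, hE⟩ := Nat.find_spec hex
    refine ⟨Nat.find hex, U, le_antisymm (coverNumber_le U hU hE) ?_, hU, hE⟩
    exact le_iInf₂ fun k hk => by exact_mod_cast Nat.find_min' hex hk
  · refine absurd (iInf₂_eq_top.2 fun k hk => absurd ⟨k, hk⟩ hex) h

theorem lowerBoxDim_le {v : ℝ} {E : Set (EuclideanSpace ℝ (Fin d))}
    (h : ∃ᶠ r : ℝ in 𝓝[>] 0, (coverNumber r E : ℝ≥0∞) ≤ ENNReal.ofReal (r ^ (-v))) :
    lowerBoxDim E ≤ v := by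
  refine liminf_le_of_frequently_le' ((h.and_eventually eventually_mem_Ioo_nhdsGT_zero).mono ?_)
  rintro r ⟨hr, h0, h1⟩
  exact log_div_neg_log_le h0 h1 hr

/-- Mass distribution principle for the lower box dimension. -/
theorem le_lowerBoxDim {v C : ℝ} {F : Set (EuclideanSpace ℝ (Fin d))}
    {μ : Measure (EuclideanSpace ℝ (Fin d))} [IsFiniteMeasure μ] (hF : μ F ≠ 0)
    (h : ∀ᶠ r : ℝ in 𝓝[>] 0, ∀ U : Set (EuclideanSpace ℝ (Fin d)),
      Metric.ediam U ≤ ENNReal.ofReal r → μ U ≤ ENNReal.ofReal (C * r ^ v)) :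
    (v : EReal) ≤ lowerBoxDim F := by
  refine EReal.ge_of_forall_gt_iff_ge.1 fun w hw => ?_
  refine le_liminf_of_le (by isBoundedDefault) ?_
  filter_upwards [h, eventually_mem_Ioo_nhdsGT_zero, eventually_const_mul_rpow_le
    (C / (μ F).toReal) (show w < v by exact_mod_cast hw)] with r hr hr01 hC
  refine le_log_div_neg_log hr01.1 hr01.2 ?_
  by_cases htop : coverNumber r F = ⊤
  · simp [htop]
  obtain ⟨k, U, hk, hU, hcov⟩ := exists_cover_of_coverNumber_ne_top htop
  have hm : 0 < (μ F).toReal := ENNReal.toReal_pos hF (measure_ne_top _ _)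
  have h1 : μ F ≤ k * ENNReal.ofReal ((μ F).toReal * r ^ w) := by
    calc μ F ≤ ∑ i, μ (U i) := (measure_mono hcov).trans (measure_iUnion_fintype_le _ _)
      _ ≤ ∑ _i : Fin k, ENNReal.ofReal ((μ F).toReal * r ^ w) := by
        refine Finset.sum_le_sum fun i _ => (hr _ (hU i)).trans (ENNReal.ofReal_le_ofReal ?_)
        calc C * r ^ v = (μ F).toReal * (C / (μ F).toReal * r ^ v) := by field_simp
          _ ≤ _ := by gcongr
      _ = _ := by simp
  rw [hk, ENat.toENNReal_coe, ← ENNReal.ofReal_natCast]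
  refine ENNReal.ofReal_le_ofReal ?_
  rw [← ENNReal.ofReal_natCast, ← ENNReal.ofReal_mul (Nat.cast_nonneg _)] at h1
  have hp := Real.rpow_pos_of_pos hr01.1 w
  have h2 := ENNReal.toReal_le_of_le_ofReal (by positivity) h1
  rw [Real.rpow_neg hr01.1.le, inv_le_iff_one_le_mul₀ hp]
  nlinarith

theorem modifiedLowerBoxDim_le_lowerBoxDim {E : Set (EuclideanSpace ℝ (Fin d))}
    (hE : IsCompact E) : modifiedLowerBoxDim E ≤ lowerBoxDim E :=
  (iInf_le_of_le (fun _ => E) <| iInf₂_le_of_le (fun _ => hE) (Set.subset_iUnion (fun _ : ℕ => E) 0)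
    le_rfl).trans (by simp)

/-- Some member of any countable cover has positive mass, and the hypothesis on `μ` does not depend
on that member, so the mass distribution principle applies to it. -/
theorem le_modifiedLowerBoxDim {v C : ℝ} {E : Set (EuclideanSpace ℝ (Fin d))}
    {μ : Measure (EuclideanSpace ℝ (Fin d))} [IsFiniteMeasure μ] (hE : μ E ≠ 0)
    (h : ∀ᶠ r : ℝ in 𝓝[>] 0, ∀ U : Set (EuclideanSpace ℝ (Fin d)),
      Metric.ediam U ≤ ENNReal.ofReal r → μ U ≤ ENNReal.ofReal (C * r ^ v)) :
    (v : EReal) ≤ modifiedLowerBoxDim E := by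
  refine le_iInf fun F => le_iInf₂ fun _ hcov => ?_
  obtain ⟨i, hi⟩ : ∃ i, μ (F i) ≠ 0 := by
    by_contra! hcon
    exact hE (measure_mono_null hcov (measure_iUnion_null hcon))
  exact (le_lowerBoxDim hi h).trans (le_iSup (fun i => lowerBoxDim (F i)) i)

/-! ### Upper correlation dimension -/

/-- Make the cover disjoint. Each piece lies in the `r`-ball about any of its points, so the
integral is at least the sum of squared masses. By Cauchy–Schwarz, `k` masses with sum `1` have
squares summing to at least `1 / k`. -/
theorem inv_card_le_lintegral_measure_closedBall {r : ℝ} {k : ℕ}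
    {μ : Measure (EuclideanSpace ℝ (Fin d))} [IsProbabilityMeasure μ]
    {U : Fin k → Set (EuclideanSpace ℝ (Fin d))}
    (hr : 0 ≤ r) (hU : ∀ i, Metric.ediam (U i) ≤ ENNReal.ofReal r) (hcov : μ (⋃ i, U i)ᶜ = 0) :
    (k : ℝ≥0∞)⁻¹ ≤ ∫⁻ x, μ (Metric.closedBall x r) ∂μ := by
  -- Closures have the same diameter and are measurable.
  set V : Fin k → Set (EuclideanSpace ℝ (Fin d)) := fun i => closure (U i)
  set D := disjointed V
  have hDm : ∀ i, MeasurableSet (D i) := fun i =>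
    disjointedRec (p := MeasurableSet) (fun _ _ h => h.diff isClosed_closure.measurableSet)
      isClosed_closure.measurableSet
  have hD : Pairwise (Function.onFun Disjoint D) := disjoint_disjointed V
  have hDU : ⋃ i, D i = ⋃ i, V i := iUnion_disjointed
  have hsum : ∑ i, μ (D i) = 1 := by
    rw [← tsum_fintype (L := SummationFilter.unconditional _), ← measure_iUnion hD hDm, hDU]
    refine (prob_compl_eq_zero_iff (MeasurableSet.iUnion fun i =>
      isClosed_closure.measurableSet)).1 (measure_mono_null (Set.compl_subset_compl.2 ?_) hcov)
    exact Set.iUnion_mono fun i => subset_closure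
  have hball : ∀ i, ∀ x ∈ D i, D i ⊆ Metric.closedBall x r := fun i x hx y hy => by
    have h1 : edist y x ≤ ENNReal.ofReal r :=
      (Metric.edist_le_ediam_of_mem (disjointed_subset V i hy) (disjointed_subset V i hx)).trans
        (by simpa [V] using hU i)
    rwa [edist_dist, ENNReal.ofReal_le_ofReal_iff hr] at h1
  have hint : ∑ i, μ (D i) * μ (D i) ≤ ∫⁻ x, μ (Metric.closedBall x r) ∂μ := by
    refine le_trans ?_ (setLIntegral_le_lintegral (⋃ i, D i) _)
    rw [lintegral_iUnion hDm hD, tsum_fintype]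
    refine Finset.sum_le_sum fun i _ => ?_
    rw [← setLIntegral_const]
    exact setLIntegral_mono' (hDm i) fun x hx => measure_mono (hball i x hx)
  refine le_trans ?_ hint
  have hreal : ∑ i, (μ (D i)).toReal = 1 := by
    rw [← ENNReal.toReal_sum (fun i _ => measure_ne_top _ _), hsum, ENNReal.toReal_one]
  have hcs := sq_sum_le_card_mul_sum_sq (s := Finset.univ) (f := fun i => (μ (D i)).toReal)
  rw [hreal, Finset.card_univ, Fintype.card_fin] at hcs
  have hk : (0 : ℝ) < k := by
    rcases Nat.eq_zero_or_pos k with rfl | hk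
    · simp at hreal
    · exact_mod_cast hk
  have hsq : ∑ i, μ (D i) * μ (D i) = ENNReal.ofReal (∑ i, (μ (D i)).toReal ^ 2) := by
    rw [ENNReal.ofReal_sum_of_nonneg fun i _ => sq_nonneg _]
    refine Finset.sum_congr rfl fun i _ => ?_
    rw [sq, ENNReal.ofReal_mul ENNReal.toReal_nonneg, ENNReal.ofReal_toReal (measure_ne_top _ _)]
  rw [hsq, ← ENNReal.ofReal_natCast, ← ENNReal.ofReal_inv_of_pos hk]
  refine ENNReal.ofReal_le_ofReal ?_
  rw [inv_le_iff_one_le_mul₀' hk]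
  simpa using hcs

theorem upperCorrDim_le {v : ℝ} {E : Set (EuclideanSpace ℝ (Fin d))}
    (h : ∀ᶠ r : ℝ in 𝓝[>] 0, (coverNumber r E : ℝ≥0∞) ≤ ENNReal.ofReal (r ^ (-v))) :
    upperCorrDim E ≤ v := by
  refine iSup_le fun μ => iSup₂_le fun _ hμ => ?_
  refine limsup_le_of_le (by isBoundedDefault) ?_
  filter_upwards [h, eventually_mem_Ioo_nhdsGT_zero] with r hr hr01
  refine log_div_log_le hr01.1 hr01.2 ?_
  obtain ⟨k, U, hk, hU, hcov⟩ := exists_cover_of_coverNumber_ne_top (r := r) (E := E) (by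
    rintro h
    simp [h] at hr)
  refine le_trans ?_ (inv_card_le_lintegral_measure_closedBall hr01.1.le hU
    (measure_mono_null (Set.compl_subset_compl.2 hcov) hμ))
  rw [hk, Real.rpow_neg hr01.1.le, ENNReal.ofReal_inv_of_pos (Real.rpow_pos_of_pos hr01.1 _)] at hr
  exact ENNReal.le_inv_iff_le_inv.1 (by simpa using hr)

theorem le_upperCorrDim {v : ℝ} {E : Set (EuclideanSpace ℝ (Fin d))}
    {μ : Measure (EuclideanSpace ℝ (Fin d))} [IsProbabilityMeasure μ] (hμ : μ Eᶜ = 0)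
    (h : ∃ᶠ r : ℝ in 𝓝[>] 0, ∀ x, μ (Metric.closedBall x r) ≤ ENNReal.ofReal (r ^ v)) :
    (v : EReal) ≤ upperCorrDim E := by
  refine le_trans ?_ (le_iSup_of_le μ <| le_iSup₂_of_le inferInstance hμ le_rfl)
  refine le_limsup_of_frequently_le' ((h.and_eventually eventually_mem_Ioo_nhdsGT_zero).mono ?_)
  rintro r ⟨hr, h0, h1⟩
  refine le_log_div_log h0 h1 ?_
  exact (lintegral_mono hr).trans (by simp)

/-! ### Packing dimension -/

/-- Each ball contributes at most `2 ^ w * C * δ ^ (w - v)` times its mass, and disjoint balls have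
total mass at most `1`. For `w > v` the bound vanishes as `δ → 0`. -/
theorem packingPreDelta_le {v w C δ : ℝ} {E : Set (EuclideanSpace ℝ (Fin d))}
    {μ : Measure (EuclideanSpace ℝ (Fin d))} [IsProbabilityMeasure μ] (hw : 0 ≤ w) (hvw : v ≤ w)
    (hδ : 0 < δ)
    (h : ∀ x ∈ E, ∀ r : ℝ, 0 < r → r ≤ δ →
      ENNReal.ofReal (r ^ v) ≤ ENNReal.ofReal C * μ (Metric.closedBall x r)) :
    packingPreDelta w δ E ≤ ENNReal.ofReal (2 ^ w * C * δ ^ (w - v)) := by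
  refine iSup₂_le fun B hB => ?_
  have : Countable B := hB.countable.to_subtype
  have hterm : ∀ b : B, Metric.ediam (Metric.closedBall b.1.1 b.1.2) ^ w ≤
      ENNReal.ofReal (2 ^ w * C * δ ^ (w - v)) * μ (Metric.closedBall b.1.1 b.1.2) := by
    intro b
    have hb0 := hB.radius_pos _ b.2
    have hbδ := hB.radius_le _ b.2
    have h1 : Metric.ediam (Metric.closedBall b.1.1 b.1.2) ≤ ENNReal.ofReal (2 * b.1.2) :=
      Metric.ediam_le_of_forall_dist_le fun x hx y hy => by
        rw [two_mul]
        exact (dist_triangle_right x y b.1.1).trans (add_le_add hx hy)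
    calc Metric.ediam (Metric.closedBall b.1.1 b.1.2) ^ w
        ≤ ENNReal.ofReal (2 * b.1.2) ^ w := ENNReal.rpow_le_rpow h1 hw
      _ = ENNReal.ofReal (2 ^ w * b.1.2 ^ (w - v) * b.1.2 ^ v) := by
        rw [ENNReal.ofReal_rpow_of_pos (by positivity), Real.mul_rpow (by norm_num) hb0.le,
          mul_assoc, ← Real.rpow_add hb0, sub_add_cancel]
      _ = ENNReal.ofReal (2 ^ w * b.1.2 ^ (w - v)) * ENNReal.ofReal (b.1.2 ^ v) :=
        ENNReal.ofReal_mul (by positivity)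
      _ ≤ ENNReal.ofReal (2 ^ w * δ ^ (w - v)) *
          (ENNReal.ofReal C * μ (Metric.closedBall b.1.1 b.1.2)) := by
        gcongr
        exact h _ (hB.center_mem _ b.2) _ hb0 hbδ
      _ = _ := by
        rw [← mul_assoc, ← ENNReal.ofReal_mul (by positivity)]
        ring_nf
  refine (ENNReal.tsum_le_tsum hterm).trans ?_
  rw [ENNReal.tsum_mul_left]
  refine mul_le_of_le_one_right' ?_
  refine (tsum_measure_le_measure_univ (fun b => Metric.isClosed_closedBall.nullMeasurableSet)
    ?_).trans prob_le_one
  exact fun a b hab => (hB.disjoint a.2 b.2 (by simpa [Subtype.ext_iff] using hab)).aedisjoint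

theorem packingDim_le {v C : ℝ} {E : Set (EuclideanSpace ℝ (Fin d))}
    {μ : Measure (EuclideanSpace ℝ (Fin d))} [IsProbabilityMeasure μ] (hv : 0 ≤ v)
    (h : ∀ x ∈ E, ∀ r : ℝ, 0 < r → r ≤ 1 →
      ENNReal.ofReal (r ^ v) ≤ ENNReal.ofReal C * μ (Metric.closedBall x r)) :
    packingDim E ≤ v := by
  refine EReal.le_of_forall_lt_iff_le.1 fun w hw => ?_
  have hw : v < w := by exact_mod_cast hw
  refine iInf_le_of_le w (iInf₂_le (hv.trans hw.le) ?_)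
  have hpre : packingPre w E = 0 := by
    have hlim : Tendsto (fun δ : ℝ => ENNReal.ofReal (2 ^ w * C * δ ^ (w - v))) (𝓝[>] 0)
        (𝓝 0) := by
      have h := (Real.continuousAt_rpow_const (0 : ℝ) (w - v) (Or.inr (by linarith))).tendsto
      rw [Real.zero_rpow (by linarith)] at h
      simpa using ENNReal.tendsto_ofReal
        ((h.mono_left nhdsWithin_le_nhds).const_mul (2 ^ w * C))
    refine le_antisymm (ge_of_tendsto hlim ?_) bot_le
    filter_upwards [eventually_mem_Ioo_nhdsGT_zero] with δ hδ
    exact (iInf₂_le δ hδ.1).trans (packingPreDelta_le (hv.trans hw.le) hw.le hδ.1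
      fun x hx r h0 hr => h x hx r h0 (hr.trans hδ.2.le))
  refine le_antisymm ((iInf₂_le (fun _ => E) (Set.subset_iUnion (fun _ : ℕ => E) 0)).trans ?_)
    bot_le
  simp [hpre]

/-- Take a maximal `r`-separated subset of `F` at a good scale `r < δ`. The `r`-balls about it cover
`F`, while the `r / 2`-balls form a packing with diameters exactly `r`; positive dimension is needed
here. Uniformity in the centre lets one `r` serve all balls. -/
theorem le_packingPreDelta [NeZero d] {v δ : ℝ} (hδ : 0 < δ) {F : Set (EuclideanSpace ℝ (Fin d))}
    {μ : Measure (EuclideanSpace ℝ (Fin d))}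
    (h : ∃ᶠ r : ℝ in 𝓝[>] 0, ∀ x, μ (Metric.closedBall x r) ≤ ENNReal.ofReal (r ^ v)) :
    μ F ≤ packingPreDelta v δ F := by
  obtain ⟨r, hr, hr01, hrδ⟩ := (h.and_eventually (eventually_mem_Ioo_nhdsGT_zero.and
    (Ioo_mem_nhdsGT hδ))).exists
  have hr0 := hr01.1
  obtain ⟨S, hS⟩ : ∃ S, Maximal (fun S : Set (EuclideanSpace ℝ (Fin d)) =>
      S ⊆ F ∧ S.Pairwise fun x y => r < dist x y) S := by
    refine zorn_subset _ fun c hc hchain => ⟨⋃₀ c, ⟨Set.sUnion_subset fun A hA => (hc hA).1, ?_⟩,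
      fun A hA => Set.subset_sUnion_of_mem hA⟩
    exact (Set.pairwise_sUnion hchain.directedOn).2 fun A hA => (hc hA).2
  have hcov : F ⊆ ⋃ x ∈ S, Metric.closedBall x r := by
    intro y hy
    by_contra! hcon
    simp only [Set.mem_iUnion, Metric.mem_closedBall, not_exists, not_le] at hcon
    have hmem : y ∈ S := hS.le_of_ge (y := insert y S) ⟨Set.insert_subset hy hS.prop.1,
      hS.prop.2.insert fun x hx _ => ⟨hcon x hx, by rw [dist_comm]; exact hcon x hx⟩⟩
      (Set.subset_insert _ _) (Set.mem_insert _ _)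
    have := hcon y hmem
    rw [dist_self] at this
    exact this.not_gt hr0
  have hdisj : S.PairwiseDisjoint fun x => Metric.closedBall x (r / 2) := fun x hx y hy hxy =>
    Metric.closedBall_disjoint_closedBall (by linarith [hS.prop.2 hx hy hxy])
  have hcount : S.Countable := hdisj.countable_of_nonempty_interior fun x _ =>
    ⟨x, Metric.ball_subset_interior_closedBall (Metric.mem_ball_self (by positivity))⟩
  have hinj : Set.InjOn (fun x : EuclideanSpace ℝ (Fin d) => (x, r / 2)) S :=
    fun x _ y _ hxy => congrArg Prod.fst hxy
  have hB : IsPacking δ F ((fun x => (x, r / 2)) '' S) := by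
    refine ⟨hcount.image _, ?_, ?_, ?_, ?_⟩
    · rintro _ ⟨x, hx, rfl⟩; exact hS.prop.1 hx
    · rintro _ ⟨x, hx, rfl⟩; exact half_pos hr0
    · rintro _ ⟨x, hx, rfl⟩
      have := hrδ.2
      simp only
      linarith
    · exact (hinj.pairwiseDisjoint_image).2 hdisj
  refine le_trans ?_ (le_iSup₂ (f := fun B (_ : IsPacking δ F B) =>
    ∑' b : B, Metric.ediam (Metric.closedBall b.1.1 b.1.2) ^ v) _ hB)
  rw [tsum_image (fun b : EuclideanSpace ℝ (Fin d) × ℝ =>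
    Metric.ediam (Metric.closedBall b.1 b.2) ^ v) hinj]
  have : Countable S := hcount.to_subtype
  refine (measure_mono hcov).trans ((measure_biUnion_le μ hcount _).trans ?_)
  refine ENNReal.tsum_le_tsum fun x => (hr x).trans ?_
  have hdiam : Metric.ediam (Metric.closedBall (x : EuclideanSpace ℝ (Fin d)) (r / 2)) =
      ENNReal.ofReal r := by
    rw [← ENNReal.ofReal_toReal (a := Metric.ediam _) Metric.isBounded_closedBall.ediam_ne_top]
    congr 1
    exact (Metric.diam_closedBall_eq _ (by positivity)).trans (by ring)
  rw [hdiam, ENNReal.ofReal_rpow_of_pos hr0]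

theorem measure_le_packingMeasure [NeZero d] {v : ℝ} {E : Set (EuclideanSpace ℝ (Fin d))}
    {μ : Measure (EuclideanSpace ℝ (Fin d))}
    (h : ∃ᶠ r : ℝ in 𝓝[>] 0, ∀ x, μ (Metric.closedBall x r) ≤ ENNReal.ofReal (r ^ v)) :
    μ E ≤ packingMeasure v E := by
  refine le_iInf₂ fun F hF => ?_
  refine (measure_mono hF).trans ((measure_iUnion_le F).trans ?_)
  exact ENNReal.tsum_le_tsum fun i => le_iInf₂ fun δ hδ => le_packingPreDelta hδ h

theorem le_packingDim [NeZero d] {v : ℝ} {E : Set (EuclideanSpace ℝ (Fin d))}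
    {μ : Measure (EuclideanSpace ℝ (Fin d))} (hE : μ E ≠ 0)
    (h : ∀ u < v, ∃ᶠ r : ℝ in 𝓝[>] 0, ∀ x, μ (Metric.closedBall x r) ≤ ENNReal.ofReal (r ^ u)) :
    (v : EReal) ≤ packingDim E := by
  refine le_iInf fun u => le_iInf₂ fun _ hu => ?_
  by_contra! hlt
  exact hE (le_antisymm (hu ▸ measure_le_packingMeasure (h u (by exact_mod_cast hlt))) bot_le)

/-! ### Coin-tossing measure and dimensions of coded Cantor sets -/

/-- The fair coin-tossing measure on the space of binary sequences. -/
noncomputable def coinMeasure : Measure (ℕ → Bool) :=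
  Measure.infinitePi fun _ => (PMF.uniformOfFintype Bool).toMeasure

instance : IsProbabilityMeasure coinMeasure := by
  unfold coinMeasure; infer_instance

theorem coinMeasure_agree (w : ℕ → Bool) (k : ℕ) :
    coinMeasure {x | ∀ i < k, x i = w i} = ENNReal.ofReal (2 ^ (-(k : ℝ))) := by
  have h : {x : ℕ → Bool | ∀ i < k, x i = w i} =
      Set.pi (Finset.range k : Set ℕ) fun i => {w i} := by
    ext x; simp [Set.mem_pi]
  rw [h, coinMeasure, Measure.infinitePi_pi _ (fun _ _ => measurableSet_singleton _)]
  simp only [PMF.toMeasure_apply_singleton _ _ (measurableSet_singleton _),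
    PMF.uniformOfFintype_apply, Fintype.card_bool, Finset.prod_const, Finset.card_range]
  rw [Real.rpow_neg (by norm_num), Real.rpow_natCast, ENNReal.ofReal_inv_of_pos (by positivity),
    ENNReal.ofReal_pow (by norm_num), ENNReal.inv_pow]
  norm_num

/-- A coding of a Cantor set by binary sequences: sequences with a common prefix of length `k`
are `ℓ k`-close, and points that are `δ * ℓ k`-close have a common prefix of length `k + 1`. -/
structure IsCantorCoding {X : Type*} [PseudoMetricSpace X] (δ : ℝ) (ℓ : ℕ → ℝ)
    (ψ : (ℕ → Bool) → X) : Prop where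
  delta_pos : 0 < δ
  pos : ∀ k, 0 < ℓ k
  tendsto : Tendsto ℓ atTop (𝓝 0)
  continuous : Continuous ψ
  dist_le : ∀ k x y, (∀ i < k, x i = y i) → dist (ψ x) (ψ y) ≤ ℓ k
  agree : ∀ k x y, dist (ψ x) (ψ y) < δ * ℓ k → ∀ i < k + 1, x i = y i

namespace IsCantorCoding

variable {d : ℕ} {δ : ℝ} {ℓ : ℕ → ℝ} {ψ : (ℕ → Bool) → EuclideanSpace ℝ (Fin d)}

theorem exists_le_forall_lt (h : IsCantorCoding δ ℓ ψ) {r : ℝ} (hr : 0 < r) :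
    ∃ k, ℓ k ≤ r ∧ ∀ j < k, r < ℓ j := by
  classical
  have hex : ∃ k, ℓ k ≤ r := (h.tendsto.eventually_le_const hr).exists
  exact ⟨Nat.find hex, Nat.find_spec hex, fun j hj => not_le.1 (Nat.find_min hex hj)⟩

theorem map_le_of_ediam_le (h : IsCantorCoding δ ℓ ψ) {r : ℝ} {k : ℕ} (hr : 0 ≤ r)
    (hrk : r < δ * ℓ k) {U : Set (EuclideanSpace ℝ (Fin d))}
    (hU : Metric.ediam U ≤ ENNReal.ofReal r) :
    coinMeasure.map ψ U ≤ ENNReal.ofReal (2 ^ (-((k + 1 : ℕ) : ℝ))) := by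
  refine (measure_mono subset_closure).trans ?_
  rw [Measure.map_apply h.continuous.measurable isClosed_closure.measurableSet]
  -- All codes of points in `closure U` share their first `k + 1` digits with one fixed code `w`.
  rcases (ψ ⁻¹' closure U).eq_empty_or_nonempty with he | ⟨w, hw⟩
  · simp [he]
  rw [← coinMeasure_agree w]
  refine measure_mono fun x hx => h.agree k x w (lt_of_le_of_lt ?_ hrk)
  have h1 : edist (ψ x) (ψ w) ≤ ENNReal.ofReal r :=
    (Metric.edist_le_ediam_of_mem (s := closure U) hx hw).trans (by simpa using hU)
  rwa [edist_dist, ENNReal.ofReal_le_ofReal_iff hr] at h1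

theorem coverNumber_le (h : IsCantorCoding δ ℓ ψ) {r : ℝ} {k : ℕ} (hr : ℓ k ≤ r) :
    (coverNumber r (Set.range ψ) : ℝ≥0∞) ≤ ENNReal.ofReal (2 ^ (k : ℝ)) := by
  let e : Fin (2 ^ k) ≃ (Fin k → Bool) := Fintype.equivFinOfCardEq (by simp) |>.symm
  have h1 : coverNumber r (Set.range ψ) ≤ (2 ^ k : ℕ) := by
    refine FractalDim.coverNumber_le (fun j => ψ '' {x | ∀ i : Fin k, x i = e j i}) ?_ ?_
    · intro j
      refine Metric.ediam_le_of_forall_dist_le ?_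
      rintro _ ⟨x, hx, rfl⟩ _ ⟨y, hy, rfl⟩
      exact (h.dist_le k x y fun i hi => (hx ⟨i, hi⟩).trans (hy ⟨i, hi⟩).symm).trans hr
    · rintro _ ⟨x, rfl⟩
      exact Set.mem_iUnion.2 ⟨e.symm fun i => x i, x, by simp, rfl⟩
  rw [Real.rpow_natCast]
  refine (ENat.toENNReal_le.2 h1).trans (le_of_eq ?_)
  rw [ENat.toENNReal_coe, ← ENNReal.ofReal_natCast]
  norm_cast

theorem le_map_closedBall (h : IsCantorCoding δ ℓ ψ) {r : ℝ} {k : ℕ} (hr : ℓ k ≤ r)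
    (w : ℕ → Bool) :
    ENNReal.ofReal (2 ^ (-(k : ℝ))) ≤ coinMeasure.map ψ (Metric.closedBall (ψ w) r) := by
  rw [Measure.map_apply h.continuous.measurable Metric.isClosed_closedBall.measurableSet,
    ← coinMeasure_agree w]
  exact measure_mono fun x hx => (h.dist_le k x w hx).trans hr

theorem ediam_closedBall_le {x : EuclideanSpace ℝ (Fin d)} {r : ℝ} :
    Metric.ediam (Metric.closedBall x r) ≤ ENNReal.ofReal (2 * r) :=
  Metric.ediam_le_of_forall_dist_le fun y hy z hz => by
    rw [two_mul]
    exact (dist_triangle_right y z x).trans (add_le_add hy hz)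

theorem isCompact_range (h : IsCantorCoding δ ℓ ψ) : IsCompact (Set.range ψ) :=
  _root_.isCompact_range h.continuous

theorem map_compl_range (h : IsCantorCoding δ ℓ ψ) : coinMeasure.map ψ (Set.range ψ)ᶜ = 0 := by
  rw [Measure.map_apply h.continuous.measurable h.isCompact_range.isClosed.measurableSet.compl]
  simp

theorem map_range_ne_zero (h : IsCantorCoding δ ℓ ψ) : coinMeasure.map ψ (Set.range ψ) ≠ 0 := by
  rw [Measure.map_apply h.continuous.measurable h.isCompact_range.isClosed.measurableSet]
  simp

theorem le_modifiedLowerBoxDim {t : ℝ} (h : IsCantorCoding δ ℓ ψ) (ht : 0 < t)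
    (hℓ : ∀ k : ℕ, 2 ^ (-(k : ℝ)) ≤ ℓ k ^ t) :
    (t : EReal) ≤ modifiedLowerBoxDim (Set.range ψ) := by
  have := Measure.isProbabilityMeasure_map h.continuous.aemeasurable (μ := coinMeasure)
  have hδ := h.delta_pos
  refine FractalDim.le_modifiedLowerBoxDim (C := δ⁻¹ ^ t) h.map_range_ne_zero ?_
  filter_upwards [eventually_mem_Ioo_nhdsGT_zero] with r hr U hU
  rw [← Real.mul_rpow (by positivity) hr.1.le]
  have hr' : 0 < δ⁻¹ * r := mul_pos (by positivity) hr.1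
  obtain ⟨k, hk, hlt⟩ := h.exists_le_forall_lt hr'
  have hle := (hℓ k).trans (Real.rpow_le_rpow (h.pos k).le hk ht.le)
  refine le_trans ?_ (ENNReal.ofReal_le_ofReal hle)
  -- At level `0` the total mass `1` suffices; otherwise minimality of the level gives `r < δ * ℓ k`
  -- for its predecessor `k`.
  rcases k with _ | k
  · simpa using prob_le_one
  · refine h.map_le_of_ediam_le hr.1.le ?_ hU
    have := hlt k (Nat.lt_succ_self k)
    rwa [inv_mul_lt_iff₀ hδ] at this

theorem lowerBoxDim_le {t : ℝ} (h : IsCantorCoding δ ℓ ψ)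
    (hℓ : ∀ v > t, ∃ᶠ k : ℕ in atTop, ℓ k ^ v ≤ 2 ^ (-(k : ℝ))) :
    lowerBoxDim (Set.range ψ) ≤ t := by
  refine EReal.le_of_forall_lt_iff_le.1 fun v hv => FractalDim.lowerBoxDim_le ?_
  have hlim : Tendsto ℓ atTop (𝓝[>] 0) :=
    tendsto_nhdsWithin_iff.2 ⟨h.tendsto, Eventually.of_forall h.pos⟩
  refine hlim.frequently ((hℓ v (by exact_mod_cast hv)).mono fun k hk => ?_)
  refine (h.coverNumber_le le_rfl).trans (ENNReal.ofReal_le_ofReal ?_)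
  rw [Real.rpow_neg (by norm_num)] at hk
  rw [Real.rpow_neg (h.pos k).le]
  exact (le_inv_comm₀ (Real.rpow_pos_of_pos (h.pos k) _) (by positivity)).1 hk

/-- Interpolates from the scales `ℓ k` to every `r ≤ 1`: for the first `k` with `ℓ k ≤ r`, the
previous scale exceeds `r`, and the index shift costs the factor `2`. -/
theorem rpow_le_two_mul {s r : ℝ} (h : IsCantorCoding δ ℓ ψ) (hs : 0 < s)
    (hℓ : ∀ k : ℕ, ℓ k ^ s ≤ 2 ^ (-(k : ℝ))) (hr : 0 < r) (hr1 : r ≤ 1) :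
    ∃ k : ℕ, ℓ k ≤ r ∧ r ^ s ≤ 2 * 2 ^ (-(k : ℝ)) := by
  obtain ⟨k, hk, hlt⟩ := h.exists_le_forall_lt hr
  refine ⟨k, hk, ?_⟩
  rcases k with _ | k
  · have := Real.rpow_le_one hr.le hr1 hs.le
    norm_num
    linarith
  · refine (Real.rpow_le_rpow hr.le (hlt k (Nat.lt_succ_self k)).le hs.le).trans
      ((hℓ k).trans (le_of_eq ?_))
    rw [Nat.cast_succ, neg_add, Real.rpow_add two_pos, Real.rpow_neg_one]
    ring

theorem upperCorrDim_le {s : ℝ} (h : IsCantorCoding δ ℓ ψ) (hs : 0 < s)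
    (hℓ : ∀ k : ℕ, ℓ k ^ s ≤ 2 ^ (-(k : ℝ))) : upperCorrDim (Set.range ψ) ≤ s := by
  refine EReal.le_of_forall_lt_iff_le.1 fun v hv => FractalDim.upperCorrDim_le ?_
  filter_upwards [eventually_mem_Ioo_nhdsGT_zero, eventually_const_mul_rpow_le 2
    (show -v < -s by exact_mod_cast neg_lt_neg (EReal.coe_lt_coe_iff.1 hv))] with r hr hrC
  obtain ⟨k, hk, hrk⟩ := h.rpow_le_two_mul hs hℓ hr.1 hr.2.le
  refine (h.coverNumber_le hk).trans (ENNReal.ofReal_le_ofReal (le_trans ?_ hrC))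
  have hp := Real.rpow_pos_of_pos hr.1 s
  have h2 : (0 : ℝ) < 2 ^ (k : ℝ) := by positivity
  rw [Real.rpow_neg two_pos.le] at hrk
  rw [Real.rpow_neg hr.1.le, ← div_eq_mul_inv, le_div_iff₀ hp]
  calc (2 : ℝ) ^ (k : ℝ) * r ^ s ≤ 2 ^ (k : ℝ) * (2 * (2 ^ (k : ℝ))⁻¹) := by gcongr
    _ = 2 := by field_simp

theorem packingDim_le {s : ℝ} (h : IsCantorCoding δ ℓ ψ) (hs : 0 < s)
    (hℓ : ∀ k : ℕ, ℓ k ^ s ≤ 2 ^ (-(k : ℝ))) : packingDim (Set.range ψ) ≤ s := by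
  have := Measure.isProbabilityMeasure_map h.continuous.aemeasurable (μ := coinMeasure)
  refine FractalDim.packingDim_le (C := 2) (μ := coinMeasure.map ψ) hs.le ?_
  rintro _ ⟨w, rfl⟩ r hr hr1
  obtain ⟨k, hk, hrk⟩ := h.rpow_le_two_mul hs hℓ hr hr1
  refine (ENNReal.ofReal_le_ofReal hrk).trans ?_
  rw [ENNReal.ofReal_mul two_pos.le]
  gcongr
  exact h.le_map_closedBall hk w

theorem frequently_map_closedBall_le {s : ℝ} (h : IsCantorCoding δ ℓ ψ)
    (hℓ : ∀ u < s, ∃ᶠ k : ℕ in atTop, 2 ^ (-(k : ℝ)) ≤ ℓ k ^ u) :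
    ∀ u < s, ∃ᶠ r : ℝ in 𝓝[>] 0, ∀ x,
      coinMeasure.map ψ (Metric.closedBall x r) ≤ ENNReal.ofReal (r ^ u) := by
  intro u hu
  obtain ⟨w, huw, hws⟩ := exists_between hu
  have hδ := h.delta_pos
  -- With radius `δ / 3 * ℓ k` a ball has diameter at most `2 * δ / 3 * ℓ k`, strictly below the
  -- separation `δ * ℓ k`.
  have hlim : Tendsto (fun k => δ / 3 * ℓ k) atTop (𝓝[>] 0) := by
    refine tendsto_nhdsWithin_iff.2 ⟨?_, Eventually.of_forall fun k => ?_⟩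
    · simpa using h.tendsto.const_mul (δ / 3)
    · have := h.pos k
      exact Set.mem_Ioi.2 (by positivity)
  refine hlim.frequently (((hℓ w hws).and_eventually (hlim.eventually
    (eventually_const_mul_rpow_le ((δ / 3)⁻¹ ^ w) huw))).mono ?_)
  rintro k ⟨hk, hC⟩ x
  have hℓk := h.pos k
  refine (h.map_le_of_ediam_le (k := k) (by positivity) ?_ ediam_closedBall_le).trans
    (ENNReal.ofReal_le_ofReal (le_trans ?_ (hk.trans (le_trans (le_of_eq ?_) hC))))
  · nlinarith [mul_pos hδ hℓk]
  · exact Real.rpow_le_rpow_of_exponent_le one_le_two (by push_cast; linarith)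
  · rw [← Real.mul_rpow (by positivity) (by positivity), inv_mul_cancel_left₀ (by positivity)]

theorem le_upperCorrDim {s : ℝ} (h : IsCantorCoding δ ℓ ψ)
    (hℓ : ∀ u < s, ∃ᶠ k : ℕ in atTop, 2 ^ (-(k : ℝ)) ≤ ℓ k ^ u) :
    (s : EReal) ≤ upperCorrDim (Set.range ψ) := by
  have := Measure.isProbabilityMeasure_map h.continuous.aemeasurable (μ := coinMeasure)
  refine EReal.ge_of_forall_gt_iff_ge.1 fun u hu => ?_
  exact FractalDim.le_upperCorrDim h.map_compl_range
    (h.frequently_map_closedBall_le hℓ u (by exact_mod_cast hu))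

theorem le_packingDim [NeZero d] {s : ℝ} (h : IsCantorCoding δ ℓ ψ)
    (hℓ : ∀ u < s, ∃ᶠ k : ℕ in atTop, 2 ^ (-(k : ℝ)) ≤ ℓ k ^ u) :
    (s : EReal) ≤ packingDim (Set.range ψ) :=
  FractalDim.le_packingDim h.map_range_ne_zero (h.frequently_map_closedBall_le hℓ)

end IsCantorCoding

/-! ### Construction of the Cantor set from its scales -/

section CantorMap

variable {c : ℝ} {ℓ : ℕ → ℝ}

/-- The binary expansion with weights `(1 - c) * ℓ k`. -/
noncomputable def cantorMap (c : ℝ) (ℓ : ℕ → ℝ) (x : ℕ → Bool) : ℝ :=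
  ∑' k, if x k then (1 - c) * ℓ k else 0

theorem le_pow_mul_of_succ_le (hc0 : 0 < c) (hsucc : ∀ k, ℓ (k + 1) ≤ c * ℓ k) (k i : ℕ) :
    ℓ (i + k) ≤ c ^ i * ℓ k := by
  induction i with
  | zero => simp
  | succ i ih =>
    calc ℓ (i + 1 + k) = ℓ (i + k + 1) := by ring_nf
      _ ≤ c * ℓ (i + k) := hsucc _
      _ ≤ c * (c ^ i * ℓ k) := by gcongr
      _ = _ := by ring

theorem summable_of_succ_le (hc0 : 0 < c) (hc1 : c < 1) (hpos : ∀ k, 0 < ℓ k)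
    (hsucc : ∀ k, ℓ (k + 1) ≤ c * ℓ k) : Summable ℓ :=
  Summable.of_nonneg_of_le (fun k => (hpos k).le) (fun k => le_pow_mul_of_succ_le hc0 hsucc 0 k)
    ((summable_geometric_of_lt_one hc0.le hc1).mul_right (ℓ 0))

theorem norm_cantorMap_term_le (hc1 : c < 1) (hpos : ∀ k, 0 < ℓ k) (k : ℕ) (b : Bool) :
    ‖if b then (1 - c) * ℓ k else 0‖ ≤ (1 - c) * ℓ k := by
  have h : 0 ≤ (1 - c) * ℓ k := mul_nonneg (by linarith) (hpos k).le
  split_ifs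
  · rw [Real.norm_of_nonneg h]
  · simpa using h

theorem continuous_cantorMap (hc0 : 0 < c) (hc1 : c < 1) (hpos : ∀ k, 0 < ℓ k)
    (hsucc : ∀ k, ℓ (k + 1) ≤ c * ℓ k) : Continuous (cantorMap c ℓ) :=
  continuous_tsum (fun k => (continuous_of_discreteTopology
      (f := fun b : Bool => if b then (1 - c) * ℓ k else 0)).comp (continuous_apply k))
    ((summable_of_succ_le hc0 hc1 hpos hsucc).mul_left (1 - c))
    fun k x => norm_cantorMap_term_le hc1 hpos k (x k)

/-- The difference of two expansions, coordinate by coordinate. -/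
noncomputable def cantorDiff (c : ℝ) (ℓ : ℕ → ℝ) (x y : ℕ → Bool) (k : ℕ) : ℝ :=
  (if x k then (1 - c) * ℓ k else 0) - if y k then (1 - c) * ℓ k else 0

theorem abs_cantorDiff_le (hc1 : c < 1) (hpos : ∀ k, 0 < ℓ k) (x y : ℕ → Bool) (k : ℕ) :
    |cantorDiff c ℓ x y k| ≤ (1 - c) * ℓ k := by
  have h : 0 ≤ (1 - c) * ℓ k := mul_nonneg (by linarith) (hpos k).le
  unfold cantorDiff
  cases x k <;> cases y k <;> simp [abs_of_nonneg h, h]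

theorem abs_cantorDiff_of_ne (hc1 : c < 1) (hpos : ∀ k, 0 < ℓ k) {x y : ℕ → Bool} {k : ℕ}
    (hxy : x k ≠ y k) : |cantorDiff c ℓ x y k| = (1 - c) * ℓ k := by
  have h : 0 ≤ (1 - c) * ℓ k := mul_nonneg (by linarith) (hpos k).le
  unfold cantorDiff
  revert hxy
  cases x k <;> cases y k <;> simp [abs_of_nonneg h]

theorem summable_cantorDiff (hc0 : 0 < c) (hc1 : c < 1) (hpos : ∀ k, 0 < ℓ k)
    (hsucc : ∀ k, ℓ (k + 1) ≤ c * ℓ k) (x y : ℕ → Bool) : Summable (cantorDiff c ℓ x y) :=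
  Summable.of_norm_bounded ((summable_of_succ_le hc0 hc1 hpos hsucc).mul_left (1 - c))
    fun k => abs_cantorDiff_le hc1 hpos x y k

theorem cantorMap_sub (hc0 : 0 < c) (hc1 : c < 1) (hpos : ∀ k, 0 < ℓ k)
    (hsucc : ∀ k, ℓ (k + 1) ≤ c * ℓ k) {x y : ℕ → Bool} {k : ℕ} (hxy : ∀ i < k, x i = y i) :
    cantorMap c ℓ x - cantorMap c ℓ y = ∑' i, cantorDiff c ℓ x y (i + k) := by
  have hsum : ∀ z : ℕ → Bool, Summable fun k => if z k then (1 - c) * ℓ k else 0 := fun z =>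
    Summable.of_norm_bounded ((summable_of_succ_le hc0 hc1 hpos hsucc).mul_left (1 - c))
      fun k => norm_cantorMap_term_le hc1 hpos k (z k)
  rw [cantorMap, cantorMap, ← (hsum x).tsum_sub (hsum y)]
  change ∑' i, cantorDiff c ℓ x y i = _
  rw [← (summable_cantorDiff hc0 hc1 hpos hsucc x y).sum_add_tsum_nat_add k,
    Finset.sum_eq_zero fun i hi => ?_, zero_add]
  simp [cantorDiff, hxy i (Finset.mem_range.1 hi)]

/-- The weight `1 - c` normalises the dominating geometric series so that it sums to exactly `ℓ k`.
-/
theorem abs_tsum_cantorDiff_le (hc0 : 0 < c) (hc1 : c < 1) (hpos : ∀ k, 0 < ℓ k)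
    (hsucc : ∀ k, ℓ (k + 1) ≤ c * ℓ k) (x y : ℕ → Bool) (k : ℕ) :
    |∑' i, cantorDiff c ℓ x y (i + k)| ≤ ℓ k := by
  have hg : HasSum (fun i : ℕ => (1 - c) * ℓ k * c ^ i) (ℓ k) := by
    have h := (hasSum_geometric_of_lt_one hc0.le hc1).mul_left ((1 - c) * ℓ k)
    rwa [mul_right_comm, mul_inv_cancel₀ (by linarith : 1 - c ≠ 0), one_mul] at h
  rw [← Real.norm_eq_abs]
  refine tsum_of_norm_bounded hg fun i => (abs_cantorDiff_le hc1 hpos x y (i + k)).trans ?_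
  calc (1 - c) * ℓ (i + k) ≤ (1 - c) * (c ^ i * ℓ k) :=
        mul_le_mul_of_nonneg_left (le_pow_mul_of_succ_le hc0 hsucc k i) (by linarith)
    _ = _ := by ring

/-- The first differing digit contributes `(1 - c) * ℓ k`, and the later ones cancel at most `ℓ (k +
1) ≤ c * ℓ k`. -/
theorem le_abs_cantorMap_sub (hc0 : 0 < c) (hc1 : c < 1) (hpos : ∀ k, 0 < ℓ k)
    (hsucc : ∀ k, ℓ (k + 1) ≤ c * ℓ k) {x y : ℕ → Bool} {k : ℕ} (hxy : ∀ i < k, x i = y i)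
    (hne : x k ≠ y k) : (1 - 2 * c) * ℓ k ≤ |cantorMap c ℓ x - cantorMap c ℓ y| := by
  have hs := (summable_nat_add_iff k).2 (summable_cantorDiff hc0 hc1 hpos hsucc x y)
  rw [cantorMap_sub hc0 hc1 hpos hsucc hxy, hs.tsum_eq_zero_add, zero_add]
  have h1 := abs_tsum_cantorDiff_le hc0 hc1 hpos hsucc x y (k + 1)
  have h2 := abs_cantorDiff_of_ne hc1 hpos hne
  have h3 : ∀ i, i + 1 + k = i + (k + 1) := fun i => by ring
  simp only [h3]
  have h4 := abs_sub_abs_le_abs_add (cantorDiff c ℓ x y k) (∑' i, cantorDiff c ℓ x y (i + (k + 1)))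
  linarith [hsucc k]

theorem isCantorCoding_single {d : ℕ} (j : Fin d) (hc0 : 0 < c) (hc : c < 1 / 2)
    (hpos : ∀ k, 0 < ℓ k) (hsucc : ∀ k, ℓ (k + 1) ≤ c * ℓ k) :
    IsCantorCoding (1 - 2 * c) ℓ fun x => EuclideanSpace.single j (cantorMap c ℓ x) := by
  have hc1 : c < 1 := by linarith
  have hanti : Antitone ℓ := antitone_nat_of_succ_le fun k => (hsucc k).trans
    (mul_le_of_le_one_left (hpos k).le hc1.le)
  have hdist : ∀ x y, dist (EuclideanSpace.single j (cantorMap c ℓ x))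
      (EuclideanSpace.single j (cantorMap c ℓ y)) = |cantorMap c ℓ x - cantorMap c ℓ y| :=
    fun x y => (PiLp.dist_single_same _ _ _ _ _).trans (Real.dist_eq _ _)
  have hiso : Isometry fun a : ℝ => EuclideanSpace.single j a :=
    Isometry.of_dist_eq fun a b => PiLp.dist_single_same _ _ _ _ _
  refine ⟨by linarith, hpos, (summable_of_succ_le hc0 hc1 hpos hsucc).tendsto_atTop_zero,
    hiso.continuous.comp (continuous_cantorMap hc0 hc1 hpos hsucc), ?_, ?_⟩
  · intro k x y hxy
    rw [hdist, cantorMap_sub hc0 hc1 hpos hsucc hxy]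
    exact abs_tsum_cantorDiff_le hc0 hc1 hpos hsucc x y k
  · intro k x y hxy i
    rw [hdist] at hxy
    -- A first disagreement at some `i ≤ k` would force distance at least `(1 - 2 * c) * ℓ i`, hence
    -- at least `(1 - 2 * c) * ℓ k`.
    induction i using Nat.strong_induction_on with
    | _ i ih =>
      intro hi
      by_contra hne
      have h1 := le_abs_cantorMap_sub hc0 hc1 hpos hsucc
        (fun m hm => ih m hm (hm.trans hi)) hne
      have h2 := hanti (Nat.lt_succ_iff.1 hi)
      nlinarith

end CantorMap

/-! ### Oscillating exponents on factorial blocks -/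

section Exponents

open Nat

/-- `b k` counts `β` for every `j < k` in a block `[(2m)!, (2m+1)!)` and `α` for the others. -/
noncomputable def blockSum (α β : ℝ) (k : ℕ) : ℝ :=
  open Classical in ∑ j ∈ Finset.range k, if ∃ m, (2 * m)! ≤ j ∧ j < (2 * m + 1)! then β else α

variable {α β : ℝ}

theorem le_blockSum_succ_sub (h : α ≤ β) (k : ℕ) : blockSum α β k + α ≤ blockSum α β (k + 1) := by
  rw [blockSum, blockSum, Finset.sum_range_succ]
  gcongr
  split_ifs <;> simp [h]

theorem mul_le_blockSum (h : α ≤ β) (k : ℕ) : k * α ≤ blockSum α β k := by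
  rw [blockSum, ← nsmul_eq_mul, ← Finset.card_range k, Finset.card_range]
  refine (le_of_eq ?_).trans (Finset.card_nsmul_le_sum _ _ α fun j _ => ?_)
  · simp
  · split_ifs <;> simp [h]

theorem blockSum_le (h : α ≤ β) (k : ℕ) : blockSum α β k ≤ k * β := by
  rw [blockSum]
  refine (Finset.sum_le_card_nsmul _ _ β fun j _ => ?_).trans (le_of_eq (by simp))
  split_ifs <;> simp [h]

/-- At the end of a `β`-block, that block alone makes the average at least `β * (1 - 1 / (2 * m +
1))`. -/
theorem le_blockSum_factorial (hα : 0 ≤ α) (h : α ≤ β) (m : ℕ) :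
    ((2 * m + 1)! - (2 * m)! : ℝ) * β ≤ blockSum α β (2 * m + 1)! := by
  have hle : (2 * m)! ≤ (2 * m + 1)! := Nat.factorial_le (Nat.le_succ _)
  rw [blockSum, ← Finset.sum_range_add_sum_Ico _ hle]
  refine le_add_of_nonneg_of_le (Finset.sum_nonneg fun j _ => ?_) (le_of_eq ?_)
  · split_ifs <;> linarith
  · rw [Finset.sum_congr rfl fun j hj => if_pos ⟨m, Finset.mem_Ico.1 hj⟩]
    simp [Nat.cast_sub hle]

/-- At the end of an `α`-block, all earlier indices add at most `β / (2 * m + 2)` to the average. -/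
theorem blockSum_factorial_le (hα : 0 ≤ α) (h : α ≤ β) (m : ℕ) :
    blockSum α β (2 * m + 2)! ≤ (2 * m + 1)! * β + (2 * m + 2)! * α := by
  have hle : (2 * m + 1)! ≤ (2 * m + 2)! := Nat.factorial_le (Nat.le_succ _)
  have h1 := blockSum_le h (2 * m + 1)!
  rw [blockSum] at h1 ⊢
  rw [← Finset.sum_range_add_sum_Ico _ hle]
  refine add_le_add h1 ?_
  rw [Finset.sum_congr rfl fun j hj => if_neg ?_]
  · simp only [Finset.sum_const, Nat.card_Ico, nsmul_eq_mul]
    gcongr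
    exact Nat.sub_le _ _
  · rintro ⟨p, hp1, hp2⟩
    rw [Finset.mem_Ico] at hj
    have h2 : 2 * m + 1 < 2 * p + 1 := by
      by_contra! hcon
      exact absurd (hj.1.trans_lt hp2) (not_lt.2 (Nat.factorial_le hcon))
    exact absurd (hp1.trans_lt hj.2) (not_lt.2 (Nat.factorial_le (by omega)))

theorem frequently_le_blockSum (hα : 0 ≤ α) (h : α ≤ β) {γ : ℝ} (hγ : γ < β) :
    ∃ᶠ k : ℕ in atTop, k * γ ≤ blockSum α β k := by
  have hlim : Tendsto (fun m : ℕ => (2 * m + 1)!) atTop atTop :=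
    tendsto_atTop_mono (fun m => le_trans (by simp only [id]; omega) (Nat.self_le_factorial _)) tendsto_id
  refine hlim.frequently (Eventually.frequently ?_)
  obtain ⟨N, hN⟩ := exists_nat_ge (β / (β - γ))
  filter_upwards [eventually_ge_atTop N] with m hm
  refine le_trans ?_ (le_blockSum_factorial hα h m)
  have hm' : β ≤ (m : ℝ) * (β - γ) := by
    rw [← div_le_iff₀ (by linarith)]
    exact hN.trans (by exact_mod_cast hm)
  have hf : (0 : ℝ) < (2 * m)! := by positivity
  rw [Nat.factorial_succ]
  push_cast
  have : β ≤ (2 * m + 1) * (β - γ) := by nlinarith [Nat.cast_nonneg (α := ℝ) m]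
  nlinarith

theorem frequently_blockSum_le (hα : 0 ≤ α) (h : α ≤ β) {γ : ℝ} (hγ : α < γ) :
    ∃ᶠ k : ℕ in atTop, blockSum α β k ≤ k * γ := by
  have hlim : Tendsto (fun m : ℕ => (2 * m + 2)!) atTop atTop :=
    tendsto_atTop_mono (fun m => le_trans (by simp only [id]; omega) (Nat.self_le_factorial _)) tendsto_id
  refine hlim.frequently (Eventually.frequently ?_)
  obtain ⟨N, hN⟩ := exists_nat_ge (β / (γ - α))
  filter_upwards [eventually_ge_atTop N] with m hm
  refine (blockSum_factorial_le hα h m).trans ?_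
  have hm' : β ≤ (m : ℝ) * (γ - α) := by
    rw [← div_le_iff₀ (by linarith)]
    exact hN.trans (by exact_mod_cast hm)
  have hf : (0 : ℝ) < (2 * m + 1)! := by positivity
  rw [Nat.factorial_succ (2 * m + 1)]
  push_cast
  have : β ≤ (2 * m + 1 + 1) * (γ - α) := by nlinarith [Nat.cast_nonneg (α := ℝ) m]
  nlinarith

end Exponents

/-- There is a sequence of scales with lower exponent `t` and upper exponent `s`. -/
theorem exists_scales {s t : ℝ} (ht : 0 < t) (hts : t < s) (hs : s < 1) :
    ∃ (c : ℝ) (ℓ : ℕ → ℝ), 0 < c ∧ c < 1 / 2 ∧ (∀ k, 0 < ℓ k) ∧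
      (∀ k, ℓ (k + 1) ≤ c * ℓ k) ∧
      (∀ k : ℕ, 2 ^ (-(k : ℝ)) ≤ ℓ k ^ t) ∧ (∀ k : ℕ, ℓ k ^ s ≤ 2 ^ (-(k : ℝ))) ∧
      (∀ v > t, ∃ᶠ k : ℕ in atTop, ℓ k ^ v ≤ 2 ^ (-(k : ℝ))) ∧
      (∀ u < s, ∃ᶠ k : ℕ in atTop, 2 ^ (-(k : ℝ)) ≤ ℓ k ^ u) := by
  have hs0 : 0 < s := ht.trans hts
  have hα : 0 ≤ s⁻¹ := by positivity
  have hαβ : s⁻¹ ≤ t⁻¹ := inv_anti₀ ht hts.le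
  have h12 : (1 : ℝ) < 2 := one_lt_two
  refine ⟨2 ^ (-s⁻¹), fun k => 2 ^ (-blockSum s⁻¹ t⁻¹ k), by positivity, ?_, fun k => by positivity,
    ?_, ?_, ?_, ?_, ?_⟩
  -- Here `s < 1` makes the largest contraction ratio smaller than `1 / 2`, which leaves gaps on the
  -- line.
  · rw [one_div, ← Real.rpow_neg_one 2]
    exact Real.rpow_lt_rpow_of_exponent_lt h12 (neg_lt_neg ((one_lt_inv₀ hs0).2 hs))
  · intro k
    rw [← Real.rpow_add two_pos]
    refine Real.rpow_le_rpow_of_exponent_le h12.le ?_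
    linarith [le_blockSum_succ_sub hαβ k]
  · intro k
    rw [← Real.rpow_mul two_pos.le, Real.rpow_le_rpow_left_iff h12, neg_mul, neg_le_neg_iff]
    have := blockSum_le hαβ k
    rwa [← div_eq_mul_inv, le_div_iff₀ ht] at this
  · intro k
    rw [← Real.rpow_mul two_pos.le, Real.rpow_le_rpow_left_iff h12, neg_mul, neg_le_neg_iff]
    have := mul_le_blockSum hαβ k
    rwa [← div_eq_mul_inv, div_le_iff₀ hs0] at this
  · intro v hv
    have hv0 : 0 < v := ht.trans hv
    refine (frequently_le_blockSum hα hαβ (inv_strictAnti₀ ht hv)).mono fun k hk => ?_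
    rw [← Real.rpow_mul two_pos.le, Real.rpow_le_rpow_left_iff h12, neg_mul, neg_le_neg_iff]
    rwa [← div_eq_mul_inv, div_le_iff₀ hv0] at hk
  · intro u hu
    -- Since `u` may be nonpositive, a positive exponent `w` between `max u 0` and `s` is used so
    -- that it can be inverted.
    obtain ⟨w, hw, hws⟩ := exists_between (max_lt hu hs0)
    have hw0 : 0 < w := (le_max_right _ _).trans_lt hw
    refine (frequently_blockSum_le hα hαβ (inv_strictAnti₀ hw0 hws)).mono fun k hk => ?_
    rw [← Real.rpow_mul two_pos.le, Real.rpow_le_rpow_left_iff h12, neg_mul, neg_le_neg_iff]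
    have hb : 0 ≤ blockSum s⁻¹ t⁻¹ k := le_trans (by positivity) (mul_le_blockSum hαβ k)
    rw [← div_eq_mul_inv, le_div_iff₀ hw0] at hk
    exact (mul_le_mul_of_nonneg_left ((le_max_left _ _).trans hw.le) hb).trans hk

end FractalDim

theorem mainTheorem3 (n : ℕ) (hn : 1 ≤ n) (t s : ℝ) (ht : 0 < t) (hts : t < s) (hs : s < 1) :
    ∃ E : Set (EuclideanSpace ℝ (Fin n)), IsCompact E ∧
      FractalDim.modifiedLowerBoxDim E = (t : EReal) ∧
      FractalDim.lowerBoxDim E = (t : EReal) ∧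
      FractalDim.upperCorrDim E = (s : EReal) ∧
      FractalDim.packingDim E = (s : EReal) := by
  have : NeZero n := ⟨by omega⟩
  have hs0 : 0 < s := ht.trans hts
  obtain ⟨c, ℓ, hc0, hc, hpos, hsucc, hlow, hupp, hlow', hupp'⟩ :=
    FractalDim.exists_scales ht hts hs
  have h := FractalDim.isCantorCoding_single (0 : Fin n) hc0 hc hpos hsucc
  have h1 := h.le_modifiedLowerBoxDim ht hlow
  have h2 := FractalDim.modifiedLowerBoxDim_le_lowerBoxDim h.isCompact_range
  have h3 := h.lowerBoxDim_le hlow'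
  exact ⟨_, h.isCompact_range, le_antisymm (h2.trans h3) h1, le_antisymm h3 (h1.trans h2),
    le_antisymm (h.upperCorrDim_le hs0 hupp) (h.le_upperCorrDim hupp'),
    le_antisymm (h.packingDim_le hs0 hupp) (h.le_packingDim hupp')⟩
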